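/- Let $F/K$ be a finite Galois extension of number fields with Galois group $G$. Let $G_0(\mathbb{Z}[G])$ denote the Grothendieck group of finitely generated $\mathbb{Z}[G]$-modules, i.e. the abelian group generated by the classes $[M]$ of finitely generated $\mathbb{Z}[G]$-modules $M$, with a relation $[L]+[N]=[M]$ for every short exact sequence $0\to L\to M\to N\to 0$. For a finite $G$-stable set $S$ of places of $F$ containing all Archimedean places, let $\mathbb{Z}[S]$ be the permutation module on $S$, let $\mathcal{O}_{F,S}$ be the ring of $S$-integers of $F$, and let $\mathcal{O}_{F,S}^\times$ and $\mathrm{Cl}_{F,S}$ be its unit group and its ideal class group, with their natural $\mathbb{Z}[G]$-module structures. Let $S$ and $S'$ be two finite $G$-stable sets of places of $F$, both containing all Archimedean places. Then $$[\mathbb{Z}[S']]-[\mathcal{O}_{F,S'}^\times]+[\mathrm{Cl}_{F,S'}]=[\mathbb{Z}[S]]-[\mathcal{O}_{F,S}^\times]+[\mathrm{Cl}_{F,S}]$$ in $G_0(\mathbb{Z}[G])$. In other words, the class $[\mathbb{Z}[S]]-[\mathcal{O}_{F,S}^\times]+[\mathrm{Cl}_{F,S}]$ does not depend on $S$. -/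

import Mathlib

open NumberField IsDedekindDomain Representation
open scoped nonZeroDivisors

universe u

/-! ### The Grothendieck group of finitely generated modules -/

section Grothendieck

/-- The subgroup of the free abelian group on finitely generated left `Λ`-modules that is generated
by the elements `[L] + [N] - [M]`, one for each short exact sequence `0 → L → M → N → 0`. -/
def shortExactRelations (Λ : Type u) [Ring Λ] :
    AddSubgroup (FreeAbelianGroup (FGModuleCat.{u} Λ)) :=
  AddSubgroup.closure
    {x | ∃ (L M N : FGModuleCat.{u} Λ) (f : L →ₗ[Λ] M) (g : M →ₗ[Λ] N),
      Function.Injective f ∧ Function.Exact f g ∧ Function.Surjective g ∧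
      x = FreeAbelianGroup.of L + FreeAbelianGroup.of N - FreeAbelianGroup.of M}

/-- The Grothendieck group `G₀(Λ)` of finitely generated left `Λ`-modules.
Isomorphic modules have the same class, because an isomorphism `L ≅ M` is a short exact
sequence `0 → L → M → 0 → 0`. -/
def G0 (Λ : Type u) [Ring Λ] : Type (u + 1) :=
  FreeAbelianGroup (FGModuleCat.{u} Λ) ⧸ shortExactRelations Λ

noncomputable instance (Λ : Type u) [Ring Λ] : AddCommGroup (G0 Λ) :=
  inferInstanceAs (AddCommGroup (FreeAbelianGroup (FGModuleCat.{u} Λ) ⧸ shortExactRelations Λ))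

/-- The class `[M]` in `G₀(Λ)` of a finitely generated `Λ`-module `M`. -/
noncomputable def G0.cls (Λ : Type u) [Ring Λ] (M : Type u) [AddCommGroup M] [Module Λ M]
    [Module.Finite Λ M] : G0 Λ :=
  QuotientAddGroup.mk (s := shortExactRelations Λ) (FreeAbelianGroup.of (FGModuleCat.of Λ M))

end Grothendieck

/-- A representation on a finitely generated abelian group is finitely generated over `ℤ[G]`. -/
instance Representation.asModule_finite {G V : Type*} [Group G] [AddCommGroup V]
    [Module.Finite ℤ V] (ρ : Representation ℤ G V) :
    Module.Finite (MonoidAlgebra ℤ G) ρ.asModule := by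
  have : Module.Finite ℤ ρ.asModule := inferInstanceAs (Module.Finite ℤ V)
  exact Module.Finite.of_restrictScalars_finite ℤ (MonoidAlgebra ℤ G) ρ.asModule

/-! ### Unit groups and class groups of rings with a group action -/

section RingAction

variable (G R : Type*) [Group G] [CommRing R] [MulSemiringAction G R]

/-- The representation of `G` on the unit group of `R` (written additively), for a group `G` acting
on the ring `R` by automorphisms. -/
def unitsRep : Representation ℤ G (Additive Rˣ) where
  toFun g := (Units.map (MulSemiringAction.toRingHom G R g : R →* R)).toAdditive.toIntLinearMap
  map_one' := by
    ext x
    exact one_smul G (x.toMul : R)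
  map_mul' g h := by
    ext x
    exact mul_smul g h (x.toMul : R)

variable [IsDomain R]

theorem ClassGroup.mulEquiv_refl_apply (c : ClassGroup R) :
    ClassGroup.mulEquiv (RingEquiv.refl R) c = c := by
  obtain ⟨c, rfl⟩ := (ClassGroup.equiv (R := R) (FractionRing R)).symm.surjective c
  obtain ⟨I, rfl⟩ := QuotientGroup.mk_surjective c
  simp only [ClassGroup.mulEquiv, MulEquiv.trans_apply, MulEquiv.apply_symm_apply]
  congr 1
  change QuotientGroup.mk _ = _
  congr 1
  ext1
  change FractionalIdeal.ringEquivOfRingEquiv _ _ (RingEquiv.refl R) _ = _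
  rw [FractionalIdeal.ringEquivOfRingEquiv_refl]
  rfl

theorem ClassGroup.mulEquiv_trans_apply (g h : R ≃+* R) (c : ClassGroup R) :
    ClassGroup.mulEquiv (g.trans h) c = ClassGroup.mulEquiv h (ClassGroup.mulEquiv g c) := by
  obtain ⟨c, rfl⟩ := (ClassGroup.equiv (R := R) (FractionRing R)).symm.surjective c
  obtain ⟨I, rfl⟩ := QuotientGroup.mk_surjective c
  simp only [ClassGroup.mulEquiv, MulEquiv.trans_apply, MulEquiv.apply_symm_apply]
  congr 1
  change QuotientGroup.mk _ = QuotientGroup.mk _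
  congr 1
  ext1
  exact FractionalIdeal.ringEquivOfRingEquiv_trans_apply _ (FractionRing R) _ _ _ _

/-- The representation of `G` on the class group of `R` (written additively), for a group `G` acting
on the domain `R` by automorphisms: `g` sends the class of `I` to the class of `g(I)`. -/
noncomputable def classGroupRep : Representation ℤ G (Additive (ClassGroup R)) where
  toFun g := (ClassGroup.mulEquiv
    (MulSemiringAction.toRingEquiv G R g)).toMonoidHom.toAdditive.toIntLinearMap
  map_one' := by
    ext x
    apply Additive.toMul.injective
    have : MulSemiringAction.toRingEquiv G R 1 = RingEquiv.refl R := by ext; simp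
    change ClassGroup.mulEquiv (MulSemiringAction.toRingEquiv G R 1) x.toMul = x.toMul
    rw [this, ClassGroup.mulEquiv_refl_apply]
  map_mul' g h := by
    ext x
    apply Additive.toMul.injective
    have : MulSemiringAction.toRingEquiv G R (g * h) =
      (MulSemiringAction.toRingEquiv G R h).trans (MulSemiringAction.toRingEquiv G R g) := by
      ext; simp
    change ClassGroup.mulEquiv (MulSemiringAction.toRingEquiv G R (g * h)) x.toMul = _
    rw [this, ClassGroup.mulEquiv_trans_apply]
    rfl

end RingAction

/-! ### Finiteness for `S`-integers of number fields -/

section SIntegers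

variable {F : Type u} [Field F] [NumberField F] (T : Set (HeightOneSpectrum (𝓞 F)))

/-- The nonzero elements of `𝓞 F` that are units at all maximal ideals outside `T`. -/
def unitsOutside : Submonoid (𝓞 F) where
  carrier := {s | s ≠ 0 ∧ ∀ v ∉ T, s ∉ v.asIdeal}
  one_mem' := ⟨one_ne_zero, fun v _ ↦ v.isPrime.one_notMem⟩
  mul_mem' ha hb :=
    ⟨mul_ne_zero ha.1 hb.1, fun v hv ↦ v.isPrime.mul_notMem (ha.2 v hv) (hb.2 v hv)⟩

theorem mem_SInteger_iff (x : F) : x ∈ T.integer F ↔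
    ∀ v ∉ T, ∃ d ∉ v.asIdeal, ∃ n : 𝓞 F, x * algebraMap (𝓞 F) F d = algebraMap (𝓞 F) F n := by
  refine ⟨fun h v hv ↦ ?_, fun h v hv ↦ ?_⟩
  · obtain ⟨n, d, hnd⟩ := v.exists_primeCompl_mul_eq_of_integer x (h v hv)
    exact ⟨d, d.2, n, hnd⟩
  · obtain ⟨d, hd, n, hnd⟩ := h v hv
    have h1 := (v.valuation_eq_one_iff_notMem (K := F)).mpr hd
    have h2 : v.valuation F (x * algebraMap (𝓞 F) F d) ≤ 1 := by rw [hnd]; exact v.valuation_le_one n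
    rwa [map_mul, h1, mul_one] at h2

theorem exists_unitsOutside_mul (x : F) (hx : x ∈ T.integer F) :
    ∃ s ∈ unitsOutside T, ∃ n : 𝓞 F, x * algebraMap (𝓞 F) F s = algebraMap (𝓞 F) F n := by
  let D : Ideal (𝓞 F) :=
    { carrier := {d | ∃ n : 𝓞 F, x * algebraMap (𝓞 F) F d = algebraMap (𝓞 F) F n}
      zero_mem' := ⟨0, by simp⟩
      add_mem' := by
        rintro a b ⟨m, hm⟩ ⟨n, hn⟩
        exact ⟨m + n, by rw [map_add, map_add, mul_add, hm, hn]⟩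
      smul_mem' := by
        rintro c a ⟨m, hm⟩
        exact ⟨c * m, by rw [smul_eq_mul, map_mul, map_mul, ← hm, mul_left_comm]⟩ }
  have hD : D ∈ (Ideal (𝓞 F))⁰ := by
    rw [mem_nonZeroDivisors_iff_ne_zero]
    intro h0
    obtain ⟨a, b, hb, rfl⟩ := IsFractionRing.div_surjective (A := 𝓞 F) x
    have hb0 : b ≠ 0 := nonZeroDivisors.ne_zero hb
    have : b ∈ D := ⟨a, by
      have : (b : F) ≠ 0 := by simpa using hb0
      exact div_mul_cancel₀ _ this⟩
    rw [h0] at this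
    exact hb0 this
  have hpow : (ClassGroup.mk0 ⟨D, hD⟩) ^ classNumber F = 1 := pow_card_eq_one
  rw [← map_pow] at hpow
  have hpr : (D ^ classNumber F).IsPrincipal := by
    have := (ClassGroup.mk0_eq_one_iff (I := D ^ classNumber F)
      (pow_mem hD _)).mp (by rw [← hpow]; rfl)
    exact this
  obtain ⟨s, hs⟩ := hpr.principal
  have hs0 : s ≠ 0 := by
    rintro rfl
    have h0 : D ^ classNumber F = 0 := by rw [hs]; simp
    exact mem_nonZeroDivisors_iff_ne_zero.mp (pow_mem hD (classNumber F)) h0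
  refine ⟨s, ⟨hs0, fun v hv hsv ↦ ?_⟩, ?_⟩
  · obtain ⟨d, hd, hdD⟩ := (mem_SInteger_iff T x).mp hx v hv
    have : d ^ classNumber F ∈ Ideal.span {s} := by
      change _ ∈ Submodule.span _ _
      rw [← hs]
      exact Ideal.pow_mem_pow hdD _
    exact hd (v.isPrime.mem_of_pow_mem _ (((Ideal.span_singleton_le_iff_mem _).mpr hsv) this))
  · have : s ∈ D ^ classNumber F := by rw [hs]; exact Submodule.mem_span_singleton_self s
    exact Ideal.pow_le_self (classNumber_ne_zero F) this

instance : IsLocalization (unitsOutside T) (T.integer F) where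
  map_units := by
    rintro ⟨s, hs0, hs⟩
    have hsF : (s : F) ≠ 0 := by simpa using hs0
    refine IsUnit.of_mul_eq_one ⟨(s : F)⁻¹, fun v hv ↦ ?_⟩ (Subtype.ext (mul_inv_cancel₀ hsF))
    rw [map_inv₀, (v.valuation_eq_one_iff_notMem (K := F)).mpr (hs v hv), inv_one]
  surj := by
    rintro ⟨x, hx⟩
    obtain ⟨s, hs, n, hn⟩ := exists_unitsOutside_mul T x hx
    exact ⟨(n, ⟨s, hs⟩), Subtype.ext hn⟩
  exists_of_eq := by
    intro a b hab
    refine ⟨1, ?_⟩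
    have : (a : F) = b := congrArg (Subtype.val : T.integer F → F) hab
    simpa using this

instance : IsDedekindDomain (T.integer F) :=
  IsLocalization.isDedekindDomain (𝓞 F)
    (fun _ hs ↦ mem_nonZeroDivisors_iff_ne_zero.mpr hs.1) (M := unitsOutside T) (T.integer F)

instance : Finite (ClassGroup (T.integer F)) := by
  refine Finite.of_surjective (ClassGroup.extendedHom (𝓞 F) (T.integer F)) fun c ↦ ?_
  obtain ⟨J, rfl⟩ := ClassGroup.mk0_surjective c
  have hJ : (J.1.comap (algebraMap (𝓞 F) (T.integer F))).map (algebraMap (𝓞 F) (T.integer F)) =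
    J.1 := IsLocalization.map_under (unitsOutside T) (T.integer F) J.1
  refine ⟨ClassGroup.mk0 ⟨J.1.comap (algebraMap (𝓞 F) (T.integer F)), ?_⟩, ?_⟩
  · rw [mem_nonZeroDivisors_iff_ne_zero]
    intro h0
    rw [h0] at hJ
    exact mem_nonZeroDivisors_iff_ne_zero.mp J.2 (by rw [← hJ]; simp)
  · rw [ClassGroup.extendedHom_mk0]
    congr 1
    exact Subtype.ext hJ

/-- The group of `T`-units is finitely generated when `T` is finite. -/
theorem finite_units_integer (hT : T.Finite) : Module.Finite ℤ (Additive (T.integer F)ˣ) := by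
  have := hT.to_subtype
  let j : (T.integer F)ˣ →* Fˣ := Units.map (T.integer F).val
  let φ : (T.integer F)ˣ →* (T → Multiplicative ℤ) :=
    MonoidHom.pi fun v ↦ v.1.valuationOfNeZero.comp j
  let Φ : Additive (T.integer F)ˣ →ₗ[ℤ] Additive (T → Multiplicative ℤ) :=
    φ.toAdditive.toIntLinearMap
  let ι : Additive (𝓞 F)ˣ →ₗ[ℤ] Additive (T.integer F)ˣ :=
    (Units.map (algebraMap (𝓞 F) (T.integer F)).toMonoidHom).toAdditive.toIntLinearMap
  have hfin : Module.Finite ℤ (Additive (T → Multiplicative ℤ)) :=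
    inferInstanceAs (Module.Finite ℤ (T → ℤ))
  have hker : Φ.ker ≤ ι.range := by
    intro x hx
    have hx1 (v : HeightOneSpectrum (𝓞 F)) (y : (T.integer F)ˣ) (hy : φ y = 1) :
        v.valuation F (y : T.integer F) ≤ 1 := by
      by_cases hv : v ∈ T
      · have : v.valuationOfNeZero (j y) = 1 := congrFun hy ⟨v, hv⟩
        have h2 := v.valuationOfNeZero_eq (j y)
        rw [this] at h2
        exact h2.symm.le
      · exact y.1.2 v hv
    have hφ : φ x.toMul = 1 := hx
    have hφ' : φ x.toMul⁻¹ = 1 := by rw [map_inv, hφ, inv_one]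
    obtain ⟨a, ha⟩ := HeightOneSpectrum.mem_integers_of_valuation_le_one F _
      fun v ↦ hx1 v _ hφ
    obtain ⟨b, hb⟩ := HeightOneSpectrum.mem_integers_of_valuation_le_one F _
      fun v ↦ hx1 v _ hφ'
    have hab : a * b = 1 := by
      apply FaithfulSMul.algebraMap_injective (𝓞 F) F
      rw [map_mul, ha, hb, map_one]
      exact congrArg (Subtype.val : T.integer F → F) x.toMul.mul_inv
    refine ⟨Additive.ofMul ⟨a, b, hab, by rw [mul_comm, hab]⟩, ?_⟩
    apply Additive.toMul.injective
    exact Units.ext (Subtype.ext ha)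
  have : IsNoetherian ℤ (Additive (𝓞 F)ˣ) := inferInstance
  have hkfg : Φ.ker.FG := by
    have : IsNoetherian ℤ ι.range := inferInstance
    have h := (Submodule.fg_top _).mp (IsNoetherian.noetherian (⊤ : Submodule ℤ ι.range))
    have h2 : IsNoetherian ℤ Φ.ker := isNoetherian_of_le hker
    exact (isNoetherian_submodule.mp h2) _ le_rfl
  refine ⟨Submodule.fg_of_fg_map_of_fg_inf_ker Φ ?_ (by simpa using hkfg)⟩
  exact IsNoetherian.noetherian _

end SIntegers

/-! ### Places and Galois action -/

section Places

/-- The places of a number field: Archimedean places, and maximal ideals of the ring of integers. -/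
abbrev Place (F : Type u) [Field F] [NumberField F] : Type u :=
  InfinitePlace F ⊕ HeightOneSpectrum (𝓞 F)

variable {K : Type*} {F : Type u} [Field K] [Field F] [NumberField F] [Algebra K F]

/-- The Galois action on maximal ideals, `σ • 𝔭 = σ(𝔭)`. -/
instance : MulAction Gal(F/K) (HeightOneSpectrum (𝓞 F)) where
  smul σ v := HeightOneSpectrum.equivOfRingEquiv (MulSemiringAction.toRingEquiv Gal(F/K) (𝓞 F) σ) v
  one_smul v := by
    ext x
    exact Iff.rfl
  mul_smul σ τ v := by
    ext x
    exact Iff.rfl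

theorem smul_notMem_smul_asIdeal (σ : Gal(F/K)) (v : HeightOneSpectrum (𝓞 F)) {d : 𝓞 F}
    (hd : d ∉ v.asIdeal) : σ • d ∉ (σ • v).asIdeal := by
  intro h
  have h1 : (MulSemiringAction.toRingEquiv Gal(F/K) (𝓞 F) σ).symm (σ • d) ∈ v.asIdeal := h
  have h2 : (MulSemiringAction.toRingEquiv Gal(F/K) (𝓞 F) σ).symm (σ • d) = d :=
    (MulSemiringAction.toRingEquiv Gal(F/K) (𝓞 F) σ).symm_apply_apply d
  exact hd (h2 ▸ h1)

variable (S : SubMulAction Gal(F/K) (Place F))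

/-- The maximal ideals in a Galois-stable set of places. -/
def finitePart : Set (HeightOneSpectrum (𝓞 F)) := {v | Sum.inr v ∈ S}

/-- The ring `O_{F,S}` of `S`-integers of `F`. -/
noncomputable abbrev SIntegers : Subalgebra (𝓞 F) F := (finitePart S).integer F

theorem smul_mem_SIntegers (σ : Gal(F/K)) {x : F} (hx : x ∈ SIntegers S) :
    σ • x ∈ SIntegers S := by
  rw [mem_SInteger_iff] at hx ⊢
  intro v hv
  have hv' : σ⁻¹ • v ∉ finitePart S := by
    intro h
    apply hv
    have := S.smul_mem σ h
    change Sum.inr (σ • σ⁻¹ • v) ∈ S at this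
    rwa [smul_inv_smul] at this
  obtain ⟨d, hd, n, hn⟩ := hx _ hv'
  refine ⟨σ • d, ?_, σ • n, ?_⟩
  · have := smul_notMem_smul_asIdeal σ _ hd
    rwa [smul_inv_smul] at this
  · have := congrArg (σ • ·) hn
    simp only [smul_mul'] at this
    rwa [← algebraMap.smul', ← algebraMap.smul'] at this

/-- The Galois action on `O_{F,S}`, restricted from `F`. -/
noncomputable instance : MulSemiringAction Gal(F/K) (SIntegers S) where
  smul σ x := ⟨σ • (x : F), smul_mem_SIntegers S σ x.2⟩
  one_smul _ := Subtype.ext (one_smul _ _)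
  mul_smul _ _ _ := Subtype.ext (mul_smul _ _ _)
  smul_zero _ := Subtype.ext (smul_zero _)
  smul_add _ _ _ := Subtype.ext (smul_add _ _ _)
  smul_one _ := Subtype.ext (smul_one _)
  smul_mul _ _ _ := Subtype.ext (smul_mul' _ _ _)

/-- The permutation module `ℤ[S]`, as a `ℤ[G]`-module. -/
abbrev PlacesModule : Type u := (ofMulAction ℤ Gal(F/K) S).asModule

/-- The unit group of `O_{F,S}`, as a `ℤ[G]`-module. -/
abbrev SUnitsModule : Type u := (unitsRep Gal(F/K) (SIntegers S)).asModule

/-- The class group of `O_{F,S}`, as a `ℤ[G]`-module. -/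
abbrev SClassGroupModule : Type u := (classGroupRep Gal(F/K) (SIntegers S)).asModule

instance [Finite S] : Module.Finite ℤ (MonoidAlgebra ℤ S) :=
  Module.Finite.equiv (MonoidAlgebra.coeffLinearEquiv ℤ).symm

instance [Finite S] : Module.Finite ℤ (Additive (SIntegers S)ˣ) :=
  finite_units_integer _ (Set.Finite.preimage Sum.inr_injective.injOn
    (Set.toFinite (S : Set (Place F))))

end Places

/-! ### Exact sequences in the Grothendieck group -/

section Grothendieck

variable {Λ : Type u} [Ring Λ] {A B C L M N : Type u}
  [AddCommGroup A] [Module Λ A] [Module.Finite Λ A]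
  [AddCommGroup B] [Module Λ B] [Module.Finite Λ B]
  [AddCommGroup C] [Module Λ C] [Module.Finite Λ C]
  [AddCommGroup L] [Module Λ L] [Module.Finite Λ L]
  [AddCommGroup M] [Module Λ M] [Module.Finite Λ M]
  [AddCommGroup N] [Module Λ N] [Module.Finite Λ N]

/-! For stable sets `S ⊆ T` containing the Archimedean places, there is an exact sequence of Galois
modules 0 → O_S^× → O_T^× × ℤ[S] → ℤ[T] → Cl_S → Cl_T → 0. It is the classical sequence 0 → O_S^× →
O_T^× → ℤ[T \ S] → Cl_S → Cl_T → 0 with ℤ[T \ S] replaced by the inclusion ℤ[S] → ℤ[T], so no module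
on the complement is needed. The first map is u ↦ (u, -div u), the second (u, q) ↦ div u + q. By
`G0.cls_five_term` its alternating sum vanishes in `G0`, which is the invariance for `S ⊆ T`. Two
arbitrary sets are each compared with their union.

The arithmetic input is `divisorClass_eq_zero_iff`: the kernel of Div(𝓞 F) → Cl_T consists of the
divisors that are principal outside `T`. Together with the description of S-units by vanishing
valuations (`valuationInt_sUnitsVal`, `exists_sUnitsVal_eq`), it turns exactness into bookkeeping
with divisors. Equivariance reduces to `valuationInt_smul` and `extendedClass_smul`. -/

theorem G0.cls_add_of_exact (f : L →ₗ[Λ] M) (g : M →ₗ[Λ] N) (hf : Function.Injective f)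
    (hfg : Function.Exact f g) (hg : Function.Surjective g) :
    G0.cls Λ L + G0.cls Λ N = G0.cls Λ M := by
  rw [← sub_eq_zero]
  exact (QuotientAddGroup.eq_zero_iff _).mpr (AddSubgroup.subset_closure
    ⟨FGModuleCat.of Λ L, FGModuleCat.of Λ M, FGModuleCat.of Λ N, f, g, hf, hfg, hg, rfl⟩)

theorem G0.cls_prod : G0.cls Λ (M × N) = G0.cls Λ M + G0.cls Λ N :=
  (G0.cls_add_of_exact (LinearMap.inl Λ M N) (LinearMap.snd Λ M N) LinearMap.inl_injective
    Function.Exact.inl_snd LinearMap.snd_surjective).symm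

/-- The Euler characteristic of an exact sequence `0 → A → B → C → M → N → 0` vanishes. -/
theorem G0.cls_five_term (f : A →ₗ[Λ] B) (g : B →ₗ[Λ] C) (h : C →ₗ[Λ] M) (k : M →ₗ[Λ] N)
    (hf : Function.Injective f) (hfg : Function.Exact f g) (hgh : Function.Exact g h)
    (hhk : Function.Exact h k) (hk : Function.Surjective k) :
    G0.cls Λ A + G0.cls Λ C + G0.cls Λ N = G0.cls Λ B + G0.cls Λ M := by
  -- Cut the sequence at the images of `g` and `h`; the classes of these images cancel.
  have h1 : G0.cls Λ A + G0.cls Λ g.range = G0.cls Λ B := by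
    refine G0.cls_add_of_exact f g.rangeRestrict hf (fun x ↦ ?_) g.surjective_rangeRestrict
    rw [← hfg x, ← LinearMap.mem_ker, LinearMap.ker_rangeRestrict, LinearMap.mem_ker]
  have h2 : G0.cls Λ g.range + G0.cls Λ h.range = G0.cls Λ C := by
    refine G0.cls_add_of_exact g.range.subtype h.rangeRestrict Subtype.val_injective (fun x ↦ ?_)
      h.surjective_rangeRestrict
    rw [← LinearMap.mem_ker, LinearMap.ker_rangeRestrict, LinearMap.mem_ker, hgh x]
    simp
  have h3 : G0.cls Λ h.range + G0.cls Λ N = G0.cls Λ M := by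
    refine G0.cls_add_of_exact h.range.subtype k Subtype.val_injective (fun x ↦ ?_) hk
    rw [hhk x]
    simp
  rw [← h1, ← h2, ← h3]
  abel

end Grothendieck

/-! ### Ideal classes of `T`-integers -/

section IdealClasses

variable {F : Type u} [Field F] [NumberField F] (T : Set (HeightOneSpectrum (𝓞 F)))

/-- The class in `Cl(O_{F,T})` of the extension of a nonzero ideal of `𝓞 F`. -/
noncomputable def extendedClass : (Ideal (𝓞 F))⁰ →* ClassGroup (T.integer F) :=
  (ClassGroup.extendedHom (𝓞 F) (T.integer F)).comp ClassGroup.mk0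

omit [NumberField F] in
theorem HeightOneSpectrum.asIdeal_mem (v : HeightOneSpectrum (𝓞 F)) :
    v.asIdeal ∈ (Ideal (𝓞 F))⁰ :=
  mem_nonZeroDivisors_of_ne_zero v.ne_bot

/-- The class in `Cl(O_{F,T})` of a divisor on `𝓞 F`. -/
noncomputable def divisorClass :
    (HeightOneSpectrum (𝓞 F) →₀ ℤ) →+ Additive (ClassGroup (T.integer F)) :=
  Finsupp.liftAddHom fun v ↦ zmultiplesHom _
    (Additive.ofMul (extendedClass T ⟨v.asIdeal, HeightOneSpectrum.asIdeal_mem v⟩))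

theorem divisorClass_single (v : HeightOneSpectrum (𝓞 F)) (n : ℤ) :
    divisorClass T (Finsupp.single v n) =
      n • Additive.ofMul (extendedClass T ⟨v.asIdeal, HeightOneSpectrum.asIdeal_mem v⟩) := by
  simp [divisorClass]

theorem HeightOneSpectrum.multiplicity_mul (v : HeightOneSpectrum (𝓞 F)) {I J : Ideal (𝓞 F)}
    (hI : I ≠ 0) (hJ : J ≠ 0) :
    multiplicity v.asIdeal (I * J) = multiplicity v.asIdeal I + multiplicity v.asIdeal J :=
  _root_.multiplicity_mul v.prime
    (FiniteMultiplicity.of_prime_left v.prime (mul_ne_zero hI hJ))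

theorem HeightOneSpectrum.multiplicity_asIdeal [DecidableEq (HeightOneSpectrum (𝓞 F))]
    (v w : HeightOneSpectrum (𝓞 F)) :
    multiplicity v.asIdeal w.asIdeal = if w = v then 1 else 0 := by
  split_ifs with h
  · rw [h]
    exact multiplicity_self
  · refine multiplicity_eq_zero.mpr fun hd ↦ h ?_
    ext1
    exact (w.isMaximal.eq_of_le v.isPrime.ne_top (Ideal.dvd_iff_le.mp hd))

/-- The divisor of a nonzero ideal has the class of the ideal. -/
theorem exists_divisor (I : (Ideal (𝓞 F))⁰) : ∃ n : HeightOneSpectrum (𝓞 F) →₀ ℤ,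
    divisorClass T n = Additive.ofMul (extendedClass T I) ∧
      ∀ v : HeightOneSpectrum (𝓞 F), n v = multiplicity v.asIdeal (I : Ideal (𝓞 F)) := by
  classical
  obtain ⟨I, hI⟩ := I
  induction I using UniqueFactorizationMonoid.induction_on_prime with
  | h₁ => exact absurd rfl (mem_nonZeroDivisors_iff_ne_zero.mp hI)
  | h₂ J hJ =>
    rw [Ideal.isUnit_iff, ← Ideal.one_eq_top] at hJ
    subst hJ
    refine ⟨0, ?_, fun v ↦ ?_⟩
    · have : (⟨1, hI⟩ : (Ideal (𝓞 F))⁰) = 1 := rfl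
      rw [this, map_one, map_zero]
      rfl
    · have : ¬ v.asIdeal ∣ 1 := fun h ↦ v.prime.not_isUnit (isUnit_of_dvd_one h)
      rw [Finsupp.zero_apply, multiplicity_eq_zero.mpr this, Nat.cast_zero]
  | h₃ J p hJ hp ih =>
    obtain ⟨n, hn, hnv⟩ := ih (mem_nonZeroDivisors_of_ne_zero hJ)
    let w : HeightOneSpectrum (𝓞 F) := ⟨p, Ideal.isPrime_of_prime hp, hp.ne_zero⟩
    refine ⟨Finsupp.single w 1 + n, ?_, fun v ↦ ?_⟩
    · rw [map_add, hn, divisorClass_single, one_smul, ← ofMul_mul, ← map_mul]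
      rfl
    · have := HeightOneSpectrum.multiplicity_asIdeal v w
      simp only [Finsupp.add_apply, hnv, Finsupp.single_apply]
      rw [HeightOneSpectrum.multiplicity_mul v hp.ne_zero hJ, show p = w.asIdeal from rfl, this]
      push_cast
      rfl

/-- The ideal `v ^ classNumber F` is principal, and a generator lies in no maximal ideal other than
`v`. -/
theorem exists_mem_asIdeal_unitsOutside {v : HeightOneSpectrum (𝓞 F)} (hv : v ∈ T) :
    ∃ s ∈ unitsOutside T, s ∈ v.asIdeal := by
  have hpow : ClassGroup.mk0
      (⟨v.asIdeal, HeightOneSpectrum.asIdeal_mem v⟩ ^ classNumber F) = 1 := by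
    rw [map_pow]
    exact pow_card_eq_one
  obtain ⟨s, hs⟩ := ((ClassGroup.mk0_eq_one_iff (I := v.asIdeal ^ classNumber F)
    (pow_mem (HeightOneSpectrum.asIdeal_mem v) _)).mp hpow).principal
  have hsm : s ∈ v.asIdeal ^ classNumber F := by
    rw [hs]
    exact Submodule.mem_span_singleton_self s
  refine ⟨s, ⟨?_, fun w hw hsw ↦ hw ?_⟩, Ideal.pow_le_self (classNumber_ne_zero F) hsm⟩
  · rintro rfl
    refine pow_ne_zero (classNumber F) v.ne_bot ?_
    rw [hs]
    simp
  · have hle : v.asIdeal ^ classNumber F ≤ w.asIdeal := by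
      rw [hs]
      exact (Ideal.span_singleton_le_iff_mem _).mpr hsw
    have : v = w := by
      ext1
      exact v.isMaximal.eq_of_le w.isPrime.ne_top (w.isPrime.le_of_pow_le hle)
    rwa [← this]

/-- Some element of `v` becomes a unit among the `T`-integers, so `v` extends to the unit ideal. -/
theorem extendedClass_eq_one_of_mem {v : HeightOneSpectrum (𝓞 F)} (hv : v ∈ T) :
    extendedClass T ⟨v.asIdeal, HeightOneSpectrum.asIdeal_mem v⟩ = 1 := by
  obtain ⟨s, hs, hsv⟩ := exists_mem_asIdeal_unitsOutside T hv
  have htop : v.asIdeal.map (algebraMap (𝓞 F) (T.integer F)) = ⊤ :=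
    Ideal.eq_top_of_isUnit_mem _ (Ideal.mem_map_of_mem _ hsv)
      (IsLocalization.map_units (M := unitsOutside T) (T.integer F) ⟨s, hs⟩)
  rw [extendedClass, MonoidHom.comp_apply, ClassGroup.extendedHom_mk0,
    ← map_one (ClassGroup.mk0 (R := T.integer F))]
  congr 1
  exact Subtype.ext (htop.trans Ideal.one_eq_top.symm)

theorem divisorClass_eq_zero_of_support {n : HeightOneSpectrum (𝓞 F) →₀ ℤ}
    (hn : ∀ v ∉ T, n v = 0) : divisorClass T n = 0 := by
  rw [← n.sum_single, Finsupp.sum, map_sum]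
  refine Finset.sum_eq_zero fun v hv ↦ ?_
  have hvT : v ∈ T := by
    by_contra h
    exact Finsupp.mem_support_iff.mp hv (hn v h)
  rw [divisorClass_single, extendedClass_eq_one_of_mem T hvT, ofMul_one, smul_zero]

/-- An element of `I` lands in `J` after multiplication by some `s` invertible outside `T`. As `s ∉
v` and powers of a maximal ideal are primary, `s` cancels modulo `v ^ k`. -/
theorem le_pow_of_map_le_map {I J : Ideal (𝓞 F)}
    (h : I.map (algebraMap (𝓞 F) (T.integer F)) ≤ J.map (algebraMap (𝓞 F) (T.integer F)))
    {v : HeightOneSpectrum (𝓞 F)} (hv : v ∉ T) {k : ℕ} (hJ : J ≤ v.asIdeal ^ k) :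
    I ≤ v.asIdeal ^ k := by
  intro a ha
  obtain ⟨s, hs, hsa⟩ := (IsLocalization.algebraMap_mem_map_algebraMap_iff (unitsOutside T)
    (T.integer F) J a).mp (h (Ideal.mem_map_of_mem _ ha))
  have := v.isPrime
  exact (Ideal.IsPrime.mul_mem_pow v.asIdeal (hJ hsa)).resolve_left (hs.2 v hv)

theorem multiplicity_eq_of_map_eq_map {I J : Ideal (𝓞 F)} (hI : I ≠ 0) (hJ : J ≠ 0)
    (h : I.map (algebraMap (𝓞 F) (T.integer F)) = J.map (algebraMap (𝓞 F) (T.integer F)))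
    {v : HeightOneSpectrum (𝓞 F)} (hv : v ∉ T) :
    multiplicity v.asIdeal I = multiplicity v.asIdeal J := by
  have key {I J : Ideal (𝓞 F)} (hI : I ≠ 0)
      (h : I.map (algebraMap (𝓞 F) (T.integer F)) ≤ J.map (algebraMap (𝓞 F) (T.integer F))) :
      multiplicity v.asIdeal J ≤ multiplicity v.asIdeal I := by
    refine (FiniteMultiplicity.of_prime_left v.prime hI).le_multiplicity_of_pow_dvd ?_
    exact Ideal.dvd_iff_le.mpr (le_pow_of_map_le_map T h hv
      (Ideal.dvd_iff_le.mp (pow_multiplicity_dvd _ _)))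
  exact le_antisymm (key hJ h.ge) (key hI h.le)

/-- The valuation at `v`, written additively, with `v(x) > 0` if `x` has a pole at `v`. -/
noncomputable def valuationInt (v : HeightOneSpectrum (𝓞 F)) : Additive Fˣ →+ ℤ :=
  v.valuationOfNeZero.toAdditiveLeft

theorem valuation_eq_exp_valuationInt (v : HeightOneSpectrum (𝓞 F)) (x : Fˣ) :
    v.valuation F (x : F) = WithZero.exp (valuationInt v (Additive.ofMul x)) :=
  (v.valuationOfNeZero_eq x).symm

/-- The sign comes from the pole-positive normalisation: `valuationInt` is minus the usual order.
Principal divisors form a group, so exactness is unaffected. -/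
theorem valuationInt_algebraMap (v : HeightOneSpectrum (𝓞 F)) {a : 𝓞 F} (ha : a ≠ 0) {x : Fˣ}
    (hx : (x : F) = algebraMap (𝓞 F) F a) :
    valuationInt v (Additive.ofMul x) = -(multiplicity v.asIdeal (Ideal.span {a}) : ℤ) := by
  have h := valuation_eq_exp_valuationInt v x
  rw [hx, v.valuation_of_algebraMap, v.intValuation_eq_exp_neg_multiplicity ha] at h
  exact (WithZero.exp_injective h).symm

theorem units_div_surjective (x : Fˣ) : ∃ (a b : 𝓞 F) (y z : Fˣ), a ≠ 0 ∧ b ≠ 0 ∧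
    (y : F) = algebraMap (𝓞 F) F a ∧ (z : F) = algebraMap (𝓞 F) F b ∧ x = y / z := by
  obtain ⟨a, b, hb, hab⟩ := IsFractionRing.div_surjective (A := 𝓞 F) (x : F)
  have hb0 : b ≠ 0 := nonZeroDivisors.ne_zero hb
  have ha0 : a ≠ 0 := by
    rintro rfl
    exact x.ne_zero (by rw [← hab]; simp)
  have inj := FaithfulSMul.algebraMap_injective (𝓞 F) F
  refine ⟨a, b, Units.mk0 _ ((map_ne_zero_iff _ inj).mpr ha0),
    Units.mk0 _ ((map_ne_zero_iff _ inj).mpr hb0), ha0, hb0, rfl, rfl, Units.ext ?_⟩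
  rw [← hab]
  simp

theorem extendedClass_span_singleton {a : 𝓞 F} (ha : Ideal.span {a} ∈ (Ideal (𝓞 F))⁰) :
    extendedClass T ⟨Ideal.span {a}, ha⟩ = 1 := by
  rw [extendedClass, MonoidHom.comp_apply, (ClassGroup.mk0_eq_one_iff ha).mpr ⟨a, rfl⟩, map_one]

/-- The `T`-integers are a localization of `𝓞 F`, so every ideal is the extension of its
contraction. -/
theorem extendedClass_surjective : Function.Surjective (extendedClass T) := by
  intro c
  obtain ⟨J, rfl⟩ := ClassGroup.mk0_surjective c
  have hJ : (J.1.comap (algebraMap (𝓞 F) (T.integer F))).map (algebraMap (𝓞 F) (T.integer F)) =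
    J.1 := IsLocalization.map_under (unitsOutside T) (T.integer F) J.1
  refine ⟨⟨J.1.comap (algebraMap (𝓞 F) (T.integer F)), ?_⟩, ?_⟩
  · rw [mem_nonZeroDivisors_iff_ne_zero]
    intro h0
    rw [h0] at hJ
    exact mem_nonZeroDivisors_iff_ne_zero.mp J.2 (by rw [← hJ]; simp)
  · rw [extendedClass, MonoidHom.comp_apply, ClassGroup.extendedHom_mk0]
    congr 1
    exact Subtype.ext hJ

theorem divisorClass_surjective : Function.Surjective (divisorClass T) := by
  intro c
  obtain ⟨I, hI⟩ := extendedClass_surjective T c.toMul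
  obtain ⟨n, hn, -⟩ := exists_divisor T I
  exact ⟨n, by rw [hn, hI]; rfl⟩

/-- Two nonzero ideals with the same class in `Cl(O_{F,T})` differ, outside `T`, by a principal
divisor. -/
theorem exists_valuationInt_of_extendedClass_eq {I J : (Ideal (𝓞 F))⁰}
    (h : extendedClass T I = extendedClass T J) : ∃ x : Fˣ, ∀ v ∉ T,
      (multiplicity v.asIdeal (I : Ideal (𝓞 F)) : ℤ) - multiplicity v.asIdeal (J : Ideal (𝓞 F)) =
        valuationInt v (Additive.ofMul x) := by
  rw [extendedClass, MonoidHom.comp_apply, MonoidHom.comp_apply, ClassGroup.extendedHom_mk0,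
    ClassGroup.extendedHom_mk0, ClassGroup.mk0_eq_mk0_iff] at h
  obtain ⟨x, y, hx, hy, hxy⟩ := h
  obtain ⟨⟨a, s⟩, has⟩ := IsLocalization.surj (unitsOutside T) x
  obtain ⟨⟨b, t⟩, hbt⟩ := IsLocalization.surj (unitsOutside T) y
  set φ := algebraMap (𝓞 F) (T.integer F)
  have hφ : Function.Injective φ := FaithfulSMul.algebraMap_injective _ _
  have hs0 : (s : 𝓞 F) ≠ 0 := s.2.1
  have ht0 : (t : 𝓞 F) ≠ 0 := t.2.1
  have ha : a ≠ 0 := by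
    rintro rfl
    rw [map_zero] at has
    exact mul_ne_zero hx ((map_ne_zero_iff φ hφ).mpr hs0) has
  have hb : b ≠ 0 := by
    rintro rfl
    rw [map_zero] at hbt
    exact mul_ne_zero hy ((map_ne_zero_iff φ hφ).mpr ht0) hbt
  -- Clear denominators in x I = y J, with x = a / s and y = b / t, to get an identity between
  -- extensions of ideals of `𝓞 F`.
  have hmap : (Ideal.span {a * t} * (I : Ideal (𝓞 F))).map φ =
      (Ideal.span {b * s} * (J : Ideal (𝓞 F))).map φ := by
    have h1 : φ (a * t) = φ s * φ t * x := by rw [map_mul, ← has]; ring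
    have h2 : φ (b * s) = φ s * φ t * y := by rw [map_mul, ← hbt]; ring
    rw [Ideal.map_mul, Ideal.map_mul, Ideal.map_span, Ideal.map_span, Set.image_singleton,
      Set.image_singleton, h1, h2, ← Ideal.span_singleton_mul_span_singleton,
      ← Ideal.span_singleton_mul_span_singleton _ y, mul_assoc, mul_assoc]
    exact congrArg _ hxy
  have hI : (I : Ideal (𝓞 F)) ≠ 0 := nonZeroDivisors.ne_zero I.2
  have hJ : (J : Ideal (𝓞 F)) ≠ 0 := nonZeroDivisors.ne_zero J.2
  have hat : Ideal.span {a * (t : 𝓞 F)} ≠ 0 := by simp [ha, ht0]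
  have hbs : Ideal.span {b * (s : 𝓞 F)} ≠ 0 := by simp [hb, hs0]
  have inj := FaithfulSMul.algebraMap_injective (𝓞 F) F
  let y' : Fˣ := Units.mk0 _ ((map_ne_zero_iff _ inj).mpr (mul_ne_zero ha ht0))
  let z' : Fˣ := Units.mk0 _ ((map_ne_zero_iff _ inj).mpr (mul_ne_zero hb hs0))
  -- The ratio is (a t) / (b s), not its inverse, because `valuationInt` counts poles positively.
  refine ⟨y' / z', fun v hv ↦ ?_⟩
  have hm := multiplicity_eq_of_map_eq_map T (mul_ne_zero hat hI) (mul_ne_zero hbs hJ) hmap hv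
  rw [HeightOneSpectrum.multiplicity_mul v hat hI,
    HeightOneSpectrum.multiplicity_mul v hbs hJ] at hm
  rw [ofMul_div, map_sub, valuationInt_algebraMap v (mul_ne_zero ha ht0) (x := y') rfl,
    valuationInt_algebraMap v (mul_ne_zero hb hs0) (x := z') rfl]
  omega

/-- Every divisor is a difference of divisors of ideals. -/
theorem exists_ideals_of_divisor (n : HeightOneSpectrum (𝓞 F) →₀ ℤ) : ∃ I J : (Ideal (𝓞 F))⁰,
    ∀ v : HeightOneSpectrum (𝓞 F), n v = (multiplicity v.asIdeal (I : Ideal (𝓞 F)) : ℤ) -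
      multiplicity v.asIdeal (J : Ideal (𝓞 F)) := by
  classical
  induction n using Finsupp.induction_linear with
  | zero => exact ⟨1, 1, fun v ↦ by simp⟩
  | add m n hm hn =>
    obtain ⟨I, J, h⟩ := hm
    obtain ⟨I', J', h'⟩ := hn
    refine ⟨I * I', J * J', fun v ↦ ?_⟩
    rw [Submonoid.coe_mul, Submonoid.coe_mul,
      HeightOneSpectrum.multiplicity_mul v (nonZeroDivisors.ne_zero I.2)
        (nonZeroDivisors.ne_zero I'.2),
      HeightOneSpectrum.multiplicity_mul v (nonZeroDivisors.ne_zero J.2)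
        (nonZeroDivisors.ne_zero J'.2),
      Finsupp.add_apply, h, h']
    push_cast
    ring
  | single w k =>
    have hpow (m : ℕ) (v : HeightOneSpectrum (𝓞 F)) :
        (multiplicity v.asIdeal (w.asIdeal ^ m) : ℤ) = if w = v then (m : ℤ) else 0 := by
      rw [(FiniteMultiplicity.of_prime_left v.prime w.ne_bot).multiplicity_pow v.prime,
        HeightOneSpectrum.multiplicity_asIdeal]
      split_ifs <;> simp
    -- Positive and negative parts of `k`; at least one exponent is zero.
    refine ⟨⟨w.asIdeal ^ k.toNat, pow_mem (HeightOneSpectrum.asIdeal_mem w) _⟩,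
      ⟨w.asIdeal ^ (-k).toNat, pow_mem (HeightOneSpectrum.asIdeal_mem w) _⟩, fun v ↦ ?_⟩
    rw [hpow, hpow, Finsupp.single_apply]
    split_ifs
    · omega
    · simp

theorem divisorClass_eq_of_forall_notMem {m n : HeightOneSpectrum (𝓞 F) →₀ ℤ}
    (h : ∀ v ∉ T, m v = n v) : divisorClass T m = divisorClass T n := by
  rw [← sub_eq_zero, ← map_sub]
  exact divisorClass_eq_zero_of_support T fun v hv ↦ by simp [h v hv]

/-- A divisor has trivial class in `Cl(O_{F,T})` iff it is principal outside `T`. -/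
theorem divisorClass_eq_zero_iff (n : HeightOneSpectrum (𝓞 F) →₀ ℤ) :
    divisorClass T n = 0 ↔ ∃ x : Fˣ, ∀ v ∉ T, n v = valuationInt v (Additive.ofMul x) := by
  constructor
  · intro h
    obtain ⟨I, J, hn⟩ := exists_ideals_of_divisor n
    obtain ⟨i, hi, hi'⟩ := exists_divisor T I
    obtain ⟨j, hj, hj'⟩ := exists_divisor T J
    have hnij : n = i - j := by
      ext v
      simp [hn, hi', hj']
    rw [hnij, map_sub, sub_eq_zero, hi, hj] at h
    obtain ⟨x, hx⟩ := exists_valuationInt_of_extendedClass_eq T (Additive.ofMul.injective h)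
    exact ⟨x, fun v hv ↦ by rw [hn, hx v hv]⟩
  · rintro ⟨x, hx⟩
    obtain ⟨a, b, y, z, ha, hb, hy, hz, rfl⟩ := units_div_surjective x
    have ha' : Ideal.span {a} ∈ (Ideal (𝓞 F))⁰ :=
      mem_nonZeroDivisors_of_ne_zero (by simpa using ha)
    have hb' : Ideal.span {b} ∈ (Ideal (𝓞 F))⁰ :=
      mem_nonZeroDivisors_of_ne_zero (by simpa using hb)
    obtain ⟨i, hi, hi'⟩ := exists_divisor T ⟨_, ha'⟩
    obtain ⟨j, hj, hj'⟩ := exists_divisor T ⟨_, hb'⟩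
    rw [extendedClass_span_singleton, ofMul_one] at hi hj
    -- With x = a / b, the sign of `valuationInt` makes its divisor `j - i`, where `i` and `j` are
    -- the divisors of (a) and (b).
    rw [divisorClass_eq_of_forall_notMem T (n := j - i), map_sub, hi, hj, sub_zero]
    intro v hv
    rw [hx v hv, ofMul_div, map_sub, valuationInt_algebraMap v ha hy,
      valuationInt_algebraMap v hb hz, Finsupp.sub_apply, hi', hj']
    ring

end IdealClasses

/-! ### Equivariance and the exact sequence -/

theorem Ideal.map_ringEquiv_mem_nonZeroDivisors {R R' : Type*} [CommRing R] [IsDomain R]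
    [CommRing R'] [IsDomain R'] (g : R ≃+* R') {I : Ideal R} (hI : I ∈ (Ideal R)⁰) :
    I.map g ∈ (Ideal R')⁰ :=
  mem_nonZeroDivisors_of_ne_zero
    ((Ideal.map_eq_bot_iff_of_injective g.injective).not.mpr (nonZeroDivisors.ne_zero hI))

/-- `ClassGroup.mulEquiv` is defined through fractional ideals of the fraction ring; for an integral
ideal the transported fractional ideal is again integral, so it can be compared elementwise. -/
theorem ClassGroup.mulEquiv_mk0 {R R' : Type*} [CommRing R] [IsDedekindDomain R] [CommRing R']
    [IsDedekindDomain R'] (g : R ≃+* R') (I : (Ideal R)⁰) :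
    ClassGroup.mulEquiv g (ClassGroup.mk0 I) =
      ClassGroup.mk0 ⟨I.1.map g, Ideal.map_ringEquiv_mem_nonZeroDivisors g I.2⟩ := by
  apply (ClassGroup.equiv (FractionRing R')).injective
  simp only [ClassGroup.mulEquiv, MulEquiv.trans_apply, MulEquiv.apply_symm_apply]
  rw [ClassGroup.equiv_mk0, ClassGroup.equiv_mk0]
  change QuotientGroup.mk _ = QuotientGroup.mk _
  congr 1
  ext1
  change FractionalIdeal.ringEquivOfRingEquiv _ _ g (I.1 : FractionalIdeal R⁰ (FractionRing R)) =
    ((I.1.map g : Ideal R') : FractionalIdeal R'⁰ (FractionRing R'))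
  rw [FractionalIdeal.ringEquivOfRingEquiv_apply]
  ext x
  rw [FractionalIdeal.mem_coeIdeal]
  constructor
  · rintro ⟨y, hy, rfl⟩
    obtain ⟨a, ha, rfl⟩ := (FractionalIdeal.mem_coeIdeal _).mp hy
    exact ⟨g a, Ideal.mem_map_of_mem g ha,
      (IsFractionRing.ringEquivOfRingEquiv_algebraMap g a).symm⟩
  · rintro ⟨b, hb, rfl⟩
    obtain ⟨a, ha, rfl⟩ := (Ideal.mem_map_of_equiv g _).mp hb
    exact ⟨algebraMap R _ a, (FractionalIdeal.mem_coeIdeal _).mpr ⟨a, ha, rfl⟩,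
      IsFractionRing.ringEquivOfRingEquiv_algebraMap g a⟩

/-- An equivariant additive map of representations over `ℤ`, as a `ℤ[G]`-linear map. -/
noncomputable def AddMonoidHom.asModuleHom {G V W : Type*} [Group G] [AddCommGroup V] [Module ℤ V]
    [AddCommGroup W] [Module ℤ W] {ρ : Representation ℤ G V} {σ : Representation ℤ G W}
    (f : V →+ W) (hf : ∀ g x, f (ρ g x) = σ g (f x)) :
    ρ.asModule →ₗ[MonoidAlgebra ℤ G] σ.asModule :=
  IntertwiningMap.equivLinearMapAsModule ρ σ
    (LinearMap.intertwiningMap_of_isIntertwiningMap ρ σ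
      { f with map_smul' := fun n x ↦ by simpa using map_intCast_smul f ℤ ℤ n x } hf)

section Galois

/-! ### Galois invariance of valuations -/

variable {K : Type*} {F : Type u} [Field K] [Field F] [NumberField F] [Algebra K F]

omit [NumberField F] in
open scoped Pointwise in
theorem HeightOneSpectrum.smul_asIdeal (σ : Gal(F/K)) (v : HeightOneSpectrum (𝓞 F)) :
    (σ • v).asIdeal = σ • v.asIdeal := by
  ext x
  rw [Ideal.mem_pointwise_smul_iff_inv_smul_mem]
  exact Iff.rfl

omit [NumberField F] in
open scoped Pointwise in
-- `σ` acts on the monoid of ideals by an automorphism, which preserves multiplicities.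
theorem HeightOneSpectrum.multiplicity_smul (σ : Gal(F/K)) (v : HeightOneSpectrum (𝓞 F))
    (a : 𝓞 F) : multiplicity (σ • v).asIdeal (Ideal.span {σ • a}) =
      multiplicity v.asIdeal (Ideal.span {a}) := by
  have h : Ideal.span {σ • a} = σ • Ideal.span {a} := by
    rw [Ideal.smul_closure, Set.smul_set_singleton]
  rw [h, HeightOneSpectrum.smul_asIdeal]
  exact multiplicity_map_eq (MulDistribMulAction.toMulEquiv (Ideal (𝓞 F)) σ)

/-- Write `x` as a quotient of integers and use invariance of multiplicities. The image `y` is a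
separate variable so that units obtained from S-units can be inserted directly. -/
theorem valuationInt_smul (σ : Gal(F/K)) (v : HeightOneSpectrum (𝓞 F)) {x y : Fˣ}
    (hy : (y : F) = σ • (x : F)) :
    valuationInt (σ • v) (Additive.ofMul y) = valuationInt v (Additive.ofMul x) := by
  obtain ⟨a, b, c, d, ha, hb, hc, hd, rfl⟩ := units_div_surjective x
  have hy' : y = Units.map (σ : F →* F) c / Units.map (σ : F →* F) d := by
    ext
    simpa using hy
  have hsmul {a : 𝓞 F} {c : Fˣ} (hc : (c : F) = algebraMap (𝓞 F) F a) :
      (Units.map (σ : F →* F) c : F) = algebraMap (𝓞 F) F (σ • a) := by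
    rw [algebraMap.smul', ← hc]
    rfl
  have hne {a : 𝓞 F} (ha : a ≠ 0) : σ • a ≠ 0 := (smul_ne_zero_iff_ne σ).mpr ha
  rw [hy', ofMul_div, ofMul_div, map_sub, map_sub, valuationInt_algebraMap v ha hc,
    valuationInt_algebraMap v hb hd, valuationInt_algebraMap _ (hne ha) (hsmul hc),
    valuationInt_algebraMap _ (hne hb) (hsmul hd), HeightOneSpectrum.multiplicity_smul,
    HeightOneSpectrum.multiplicity_smul]

/-- The valuation at a place, which is zero by convention at Archimedean places. -/
noncomputable def Place.valuationInt : Place F → Additive Fˣ →+ ℤ :=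
  Sum.elim 0 _root_.valuationInt

theorem Place.valuationInt_smul (σ : Gal(F/K)) (p : Place F) {x y : Fˣ}
    (hy : (y : F) = σ • (x : F)) :
    Place.valuationInt (σ • p) (Additive.ofMul y) = Place.valuationInt p (Additive.ofMul x) := by
  obtain w | v := p
  · rfl
  · exact _root_.valuationInt_smul σ v hy

/-! ### Equivariance of ideal classes, and divisors of S-units -/

variable (S : SubMulAction Gal(F/K) (Place F))

/-- `𝓞 F → O_S` commutes with `σ`, so both classes come from extending `v` along the same ring map.
-/
theorem extendedClass_smul (σ : Gal(F/K)) (v : HeightOneSpectrum (𝓞 F)) :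
    ClassGroup.mulEquiv (MulSemiringAction.toRingEquiv Gal(F/K) (SIntegers S) σ)
        (extendedClass (finitePart S) ⟨v.asIdeal, HeightOneSpectrum.asIdeal_mem v⟩) =
      extendedClass (finitePart S) ⟨(σ • v).asIdeal, HeightOneSpectrum.asIdeal_mem _⟩ := by
  rw [extendedClass, MonoidHom.comp_apply, MonoidHom.comp_apply, ClassGroup.extendedHom_mk0,
    ClassGroup.extendedHom_mk0, ClassGroup.mulEquiv_mk0]
  congr 1
  apply Subtype.ext
  have h : (σ • v).asIdeal =
      v.asIdeal.map (MulSemiringAction.toRingEquiv Gal(F/K) (𝓞 F) σ : 𝓞 F →+* 𝓞 F) := by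
    rw [HeightOneSpectrum.smul_asIdeal]
    rfl
  change (v.asIdeal.map (algebraMap (𝓞 F) (SIntegers S))).map
    (MulSemiringAction.toRingEquiv Gal(F/K) (SIntegers S) σ : SIntegers S →+* SIntegers S) =
    (σ • v).asIdeal.map (algebraMap (𝓞 F) (SIntegers S))
  rw [h, Ideal.map_map, Ideal.map_map]
  congr 1

theorem classGroupRep_divisorClass (σ : Gal(F/K)) (n : HeightOneSpectrum (𝓞 F) →₀ ℤ) :
    classGroupRep Gal(F/K) (SIntegers S) σ (divisorClass (finitePart S) n) =
      divisorClass (finitePart S) (n.mapDomain (σ • ·)) := by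
  induction n using Finsupp.induction_linear with
  | zero => simp
  | add m n hm hn => rw [map_add, map_add, hm, hn, Finsupp.mapDomain_add, map_add]
  | single v k =>
    rw [Finsupp.mapDomain_single, divisorClass_single, divisorClass_single, map_zsmul,
      ← extendedClass_smul]
    rfl

/-- The divisor on `𝓞 F` given by the non-Archimedean part of an element of `ℤ[S]`. -/
noncomputable def finiteDivisor : MonoidAlgebra ℤ S →+ (HeightOneSpectrum (𝓞 F) →₀ ℤ) :=
  (Finsupp.comapDomain.addMonoidHom Sum.inr_injective).comp
    ((Finsupp.mapDomain.addMonoidHom (Subtype.val : S → Place F)).comp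
      (MonoidAlgebra.coeffLinearEquiv ℤ).toAddMonoidHom)

variable {S}

theorem finiteDivisor_of_mem (q : MonoidAlgebra ℤ S) {v : HeightOneSpectrum (𝓞 F)}
    (hv : v ∈ finitePart S) : finiteDivisor S q v = q.coeff ⟨Sum.inr v, hv⟩ :=
  Finsupp.mapDomain_apply Subtype.val_injective q.coeff (⟨Sum.inr v, hv⟩ : S)

theorem finiteDivisor_of_notMem (q : MonoidAlgebra ℤ S) {v : HeightOneSpectrum (𝓞 F)}
    (hv : v ∉ finitePart S) : finiteDivisor S q v = 0 := by
  refine Finsupp.mapDomain_of_notMem_range q.coeff (Sum.inr v : Place F) ?_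
  rintro ⟨⟨p, hp⟩, rfl⟩
  exact hv hp

theorem finiteDivisor_ofMulAction (σ : Gal(F/K)) (q : MonoidAlgebra ℤ S) :
    finiteDivisor S (ofMulAction ℤ Gal(F/K) S σ q) = (finiteDivisor S q).mapDomain (σ • ·) := by
  ext v
  have hmap : (finiteDivisor S q).mapDomain (σ • ·) v = finiteDivisor S q (σ⁻¹ • v) := by
    conv_lhs => rw [← smul_inv_smul σ v]
    exact Finsupp.mapDomain_apply (MulAction.injective σ) _ _
  have hiff : σ⁻¹ • v ∈ finitePart S ↔ v ∈ finitePart S :=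
    S.smul_mem_iff' σ⁻¹ (x := (Sum.inr v : Place F))
  rw [hmap]
  by_cases hv : v ∈ finitePart S
  · rw [finiteDivisor_of_mem _ hv, finiteDivisor_of_mem _ (hiff.mpr hv), coeff_ofMulAction]
    rfl
  · rw [finiteDivisor_of_notMem _ hv, finiteDivisor_of_notMem _ (hiff.not.mpr hv)]

variable (S) in
/-- The inclusion of `O_{F,S}ˣ` into `Fˣ`. -/
noncomputable def sUnitsVal : Additive (SIntegers S)ˣ →+ Additive Fˣ :=
  (Units.map ((SIntegers S).val : SIntegers S →* F)).toAdditive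

variable (S) in
/-- The map `O_{F,S}ˣ → ℤ[S]` given by the valuations at the places in `S`. -/
noncomputable def sUnitsDivisor [Finite S] : Additive (SIntegers S)ˣ →+ MonoidAlgebra ℤ S :=
  (MonoidAlgebra.coeffLinearEquiv ℤ).symm.toAddMonoidHom.comp
    ((Finsupp.linearEquivFunOnFinite ℤ ℤ S).symm.toAddMonoidHom.comp
      (AddMonoidHom.mk' (fun u p ↦ Place.valuationInt p.1 (sUnitsVal S u))
        fun u w ↦ by ext p; simp))

theorem coeff_sUnitsDivisor [Finite S] (u : Additive (SIntegers S)ˣ) (p : S) :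
    (sUnitsDivisor S u).coeff p = Place.valuationInt p.1 (sUnitsVal S u) :=
  rfl

/-- Integrality at `v`, applied to the unit and to its inverse, gives both inequalities. -/
theorem valuationInt_sUnitsVal (u : Additive (SIntegers S)ˣ) {v : HeightOneSpectrum (𝓞 F)}
    (hv : v ∉ finitePart S) : valuationInt v (sUnitsVal S u) = 0 := by
  have h (u : Additive (SIntegers S)ˣ) : valuationInt v (sUnitsVal S u) ≤ 0 := by
    have := valuation_eq_exp_valuationInt v (sUnitsVal S u).toMul
    have h1 : v.valuation F ((sUnitsVal S u).toMul : F) ≤ 1 := (u.toMul : SIntegers S).2 v hv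
    rw [this, ← WithZero.exp_zero, WithZero.exp_le_exp] at h1
    exact h1
  refine le_antisymm (h u) ?_
  have := h (-u)
  rw [map_neg, map_neg] at this
  omega

/-- Vanishing valuations outside `S` make both `x` and its inverse S-integers. -/
theorem exists_sUnitsVal_eq {x : Fˣ}
    (hx : ∀ v ∉ finitePart S, valuationInt v (Additive.ofMul x) = 0) :
    ∃ u : Additive (SIntegers S)ˣ, sUnitsVal S u = Additive.ofMul x := by
  refine ⟨Additive.ofMul ⟨⟨x, fun v hv ↦ ?_⟩, ⟨(x⁻¹ : Fˣ), fun v hv ↦ ?_⟩,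
    Subtype.ext x.mul_inv, Subtype.ext x.inv_mul⟩, ?_⟩
  · rw [valuation_eq_exp_valuationInt, hx v hv, WithZero.exp_zero]
  · rw [valuation_eq_exp_valuationInt, ofMul_inv, map_neg, hx v hv, neg_zero, WithZero.exp_zero]
  · apply Additive.toMul.injective
    ext
    rfl

theorem sUnitsDivisor_unitsRep [Finite S] (σ : Gal(F/K)) (u : Additive (SIntegers S)ˣ) :
    sUnitsDivisor S (unitsRep Gal(F/K) (SIntegers S) σ u) =
      ofMulAction ℤ Gal(F/K) S σ (sUnitsDivisor S u) := by
  ext p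
  rw [coeff_ofMulAction, coeff_sUnitsDivisor, coeff_sUnitsDivisor]
  conv_lhs => rw [← smul_inv_smul σ p]
  exact Place.valuationInt_smul σ (σ⁻¹ • p).1 rfl

theorem sUnitsVal_injective : Function.Injective (sUnitsVal S) := by
  intro u w h
  apply Additive.toMul.injective
  ext
  exact congrArg (fun x : Additive Fˣ ↦ (x.toMul : F)) h

/-! ### Comparison maps for S ⊆ T -/

variable {T : SubMulAction Gal(F/K) (Place F)} (hST : S ≤ T)

/-- The inclusion `ℤ[S] → ℤ[T]` for `S ⊆ T`. -/
noncomputable def placesInclusion : MonoidAlgebra ℤ S →+ MonoidAlgebra ℤ T :=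
  AddMonoidHom.mk' (MonoidAlgebra.mapDomain (Set.inclusion hST)) (MonoidAlgebra.mapDomain_add _)

theorem placesInclusion_injective : Function.Injective (placesInclusion hST) :=
  MonoidAlgebra.mapDomain_injective (Set.inclusion_injective hST)

theorem coeff_placesInclusion_of_mem (q : MonoidAlgebra ℤ S) {p : T} (hp : p.1 ∈ S) :
    (placesInclusion hST q).coeff p = q.coeff ⟨p.1, hp⟩ :=
  Finsupp.mapDomain_apply (Set.inclusion_injective hST) q.coeff (⟨p.1, hp⟩ : S)

theorem coeff_placesInclusion_of_notMem (q : MonoidAlgebra ℤ S) {p : T} (hp : p.1 ∉ S) :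
    (placesInclusion hST q).coeff p = 0 := by
  refine Finsupp.mapDomain_of_notMem_range q.coeff p ?_
  rintro ⟨p, rfl⟩
  exact hp p.2

theorem placesInclusion_ofMulAction (σ : Gal(F/K)) (q : MonoidAlgebra ℤ S) :
    placesInclusion hST (ofMulAction ℤ Gal(F/K) S σ q) =
      ofMulAction ℤ Gal(F/K) T σ (placesInclusion hST q) := by
  ext p
  have hiff : (σ⁻¹ • p).1 ∈ S ↔ p.1 ∈ S := S.smul_mem_iff' σ⁻¹ (x := p.1)
  rw [coeff_ofMulAction]
  by_cases hp : p.1 ∈ S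
  · rw [coeff_placesInclusion_of_mem hST _ hp, coeff_placesInclusion_of_mem hST _ (hiff.mpr hp),
      coeff_ofMulAction]
    rfl
  · rw [coeff_placesInclusion_of_notMem hST _ hp,
      coeff_placesInclusion_of_notMem hST _ (hiff.not.mpr hp)]

theorem exists_placesInclusion_eq (q : MonoidAlgebra ℤ T)
    (hq : ∀ p : T, p.1 ∉ S → q.coeff p = 0) : ∃ r, placesInclusion hST r = q := by
  refine ⟨MonoidAlgebra.comapDomain (Set.inclusion hST) (Set.inclusion_injective hST) q, ?_⟩
  ext p
  by_cases hp : p.1 ∈ S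
  · rw [coeff_placesInclusion_of_mem hST _ hp]
    rfl
  · rw [coeff_placesInclusion_of_notMem hST _ hp, hq p hp]

include hST in
theorem finitePart_mono : finitePart S ⊆ finitePart T :=
  fun _ hv ↦ hST hv

/-- The inclusion `O_{F,S}ˣ → O_{F,T}ˣ` for `S ⊆ T`. -/
noncomputable def sUnitsInclusion : Additive (SIntegers S)ˣ →+ Additive (SIntegers T)ˣ :=
  (Units.map (Subalgebra.inclusion (show SIntegers S ≤ SIntegers T from
    fun _ hx v hv ↦ hx v fun h ↦ hv (finitePart_mono hST h)) :
      SIntegers S →* SIntegers T)).toAdditive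

theorem sUnitsVal_sUnitsInclusion (u : Additive (SIntegers S)ˣ) :
    sUnitsVal T (sUnitsInclusion hST u) = sUnitsVal S u :=
  rfl

theorem sUnitsInclusion_unitsRep (σ : Gal(F/K)) (u : Additive (SIntegers S)ˣ) :
    sUnitsInclusion hST (unitsRep Gal(F/K) (SIntegers S) σ u) =
      unitsRep Gal(F/K) (SIntegers T) σ (sUnitsInclusion hST u) :=
  rfl

/-- The surjection `Cl_{F,S} → Cl_{F,T}` for `S ⊆ T`. -/
noncomputable def classGroupMap :
    Additive (ClassGroup (SIntegers S)) →+ Additive (ClassGroup (SIntegers T)) :=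
  (divisorClass (finitePart S)).liftOfSurjective (divisorClass_surjective _)
    ⟨divisorClass (finitePart T), fun n hn ↦ by
      -- A divisor that is principal outside `S` is principal outside the larger `T`, so the kernels
      -- are nested.
      obtain ⟨x, hx⟩ := (divisorClass_eq_zero_iff _ n).mp hn
      exact (divisorClass_eq_zero_iff _ n).mpr
        ⟨x, fun v hv ↦ hx v fun h ↦ hv (finitePart_mono hST h)⟩⟩

theorem classGroupMap_divisorClass (n : HeightOneSpectrum (𝓞 F) →₀ ℤ) :
    classGroupMap hST (divisorClass (finitePart S) n) = divisorClass (finitePart T) n :=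
  AddMonoidHom.liftOfRightInverse_comp_apply _ _ _ _ n

theorem classGroupMap_surjective : Function.Surjective (classGroupMap hST) := by
  intro c
  obtain ⟨n, rfl⟩ := divisorClass_surjective _ c
  exact ⟨_, classGroupMap_divisorClass hST n⟩

theorem classGroupMap_classGroupRep (σ : Gal(F/K)) (c : Additive (ClassGroup (SIntegers S))) :
    classGroupMap hST (classGroupRep Gal(F/K) (SIntegers S) σ c) =
      classGroupRep Gal(F/K) (SIntegers T) σ (classGroupMap hST c) := by
  obtain ⟨n, rfl⟩ := divisorClass_surjective _ c
  rw [classGroupRep_divisorClass, classGroupMap_divisorClass, classGroupMap_divisorClass,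
    classGroupRep_divisorClass]

theorem finiteDivisor_sUnitsDivisor [Finite T] (u : Additive (SIntegers T)ˣ)
    (v : HeightOneSpectrum (𝓞 F)) :
    finiteDivisor T (sUnitsDivisor T u) v = valuationInt v (sUnitsVal T u) := by
  by_cases hv : v ∈ finitePart T
  · rw [finiteDivisor_of_mem _ hv]
    rfl
  · rw [finiteDivisor_of_notMem _ hv, valuationInt_sUnitsVal u hv]

theorem finiteDivisor_placesInclusion (q : MonoidAlgebra ℤ S) :
    finiteDivisor T (placesInclusion hST q) = finiteDivisor S q := by
  ext v
  by_cases hv : v ∈ finitePart S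
  · rw [finiteDivisor_of_mem _ hv, finiteDivisor_of_mem _ (finitePart_mono hST hv),
      coeff_placesInclusion_of_mem hST q (p := ⟨Sum.inr v, finitePart_mono hST hv⟩) hv]
  · rw [finiteDivisor_of_notMem _ hv]
    by_cases hvT : v ∈ finitePart T
    · rw [finiteDivisor_of_mem _ hvT,
        coeff_placesInclusion_of_notMem hST q (p := ⟨Sum.inr v, hvT⟩) hv]
    · rw [finiteDivisor_of_notMem _ hvT]

/-- A place of `T` not in `S` is non-Archimedean, and an S-unit has valuation zero there. -/
theorem placesInclusion_sUnitsDivisor [Finite S] [Finite T]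
    (hS : ∀ w : InfinitePlace F, Sum.inl w ∈ S) (u : Additive (SIntegers S)ˣ) :
    placesInclusion hST (sUnitsDivisor S u) = sUnitsDivisor T (sUnitsInclusion hST u) := by
  ext p
  by_cases hp : p.1 ∈ S
  · rw [coeff_placesInclusion_of_mem hST _ hp]
    rfl
  · rw [coeff_placesInclusion_of_notMem hST _ hp, coeff_sUnitsDivisor, sUnitsVal_sUnitsInclusion]
    obtain ⟨w | v, hpT⟩ := p
    · exact absurd (hS w) hp
    · exact (valuationInt_sUnitsVal u hp).symm

/-! ### The exact sequence and its Euler characteristic -/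

variable [Finite S] [Finite T]

/-- The map `O_{F,S}ˣ → O_{F,T}ˣ × ℤ[S]`, `u ↦ (u, -div u)`. -/
noncomputable def sUnitsToProd :
    SUnitsModule S →ₗ[MonoidAlgebra ℤ Gal(F/K)] SUnitsModule T × PlacesModule S :=
  ((sUnitsInclusion hST).asModuleHom (sUnitsInclusion_unitsRep hST)).prod
    (-(sUnitsDivisor S).asModuleHom sUnitsDivisor_unitsRep)

/-- The map `O_{F,T}ˣ × ℤ[S] → ℤ[T]`, `(u, q) ↦ div u + q`. -/
noncomputable def prodToPlaces :
    SUnitsModule T × PlacesModule S →ₗ[MonoidAlgebra ℤ Gal(F/K)] PlacesModule T :=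
  ((sUnitsDivisor T).asModuleHom sUnitsDivisor_unitsRep).coprod
    ((placesInclusion hST).asModuleHom (placesInclusion_ofMulAction hST))

variable (S T) in
/-- The map `ℤ[T] → Cl_{F,S}` sending a maximal ideal in `T` to its class. -/
noncomputable def placesToClassGroup :
    PlacesModule T →ₗ[MonoidAlgebra ℤ Gal(F/K)] SClassGroupModule S :=
  ((divisorClass (finitePart S)).comp (finiteDivisor T)).asModuleHom fun σ q ↦ by
    rw [AddMonoidHom.comp_apply, finiteDivisor_ofMulAction, ← classGroupRep_divisorClass]
    rfl

omit [Finite T] in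
theorem sUnitsToProd_injective : Function.Injective (sUnitsToProd hST) := by
  intro u w h
  have h1 : sUnitsInclusion hST u = sUnitsInclusion hST w := congrArg Prod.fst h
  exact sUnitsVal_injective (congrArg (sUnitsVal T) h1)

/-- If div u' = -r with r supported on `S`, then u' has no valuation outside `S` and is an S-unit; r
is then determined by injectivity of ℤ[S] → ℤ[T]. -/
theorem exact_sUnitsToProd_prodToPlaces (hS : ∀ w : InfinitePlace F, Sum.inl w ∈ S) :
    Function.Exact (sUnitsToProd hST) (prodToPlaces hST) := by
  rintro ⟨(u' : Additive (SIntegers T)ˣ), (r : MonoidAlgebra ℤ S)⟩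
  constructor
  · intro h
    have h' : sUnitsDivisor T u' + placesInclusion hST r = 0 := h
    obtain ⟨u, hu⟩ := exists_sUnitsVal_eq (S := S) (x := (sUnitsVal T u').toMul) fun v hv ↦ by
      have : finiteDivisor T (sUnitsDivisor T u' + placesInclusion hST r) v =
          finiteDivisor T 0 v := by
        rw [h']
      rw [map_add, Finsupp.add_apply, finiteDivisor_sUnitsDivisor, finiteDivisor_placesInclusion,
        finiteDivisor_of_notMem _ hv, add_zero] at this
      simpa using this
    have huu' : sUnitsInclusion hST u = u' := sUnitsVal_injective hu
    refine ⟨u, Prod.ext huu' ?_⟩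
    apply placesInclusion_injective hST
    change placesInclusion hST (-sUnitsDivisor S u) = placesInclusion hST r
    rw [map_neg, placesInclusion_sUnitsDivisor hST hS, huu']
    exact neg_eq_of_add_eq_zero_right h'
  · rintro ⟨(u : Additive (SIntegers S)ˣ), hu⟩
    rw [← hu]
    change sUnitsDivisor T (sUnitsInclusion hST u) + placesInclusion hST (-sUnitsDivisor S u) = 0
    rw [map_neg, placesInclusion_sUnitsDivisor hST hS, add_neg_cancel]

omit [Finite S] in
-- A `q` in the kernel agrees with some div x outside `S`. Since `q` lives on `T`, x is a T-unit,
-- and `q` - div x is supported on `S`; Archimedean coefficients are absorbed by ℤ[S].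
theorem exact_prodToPlaces_placesToClassGroup (hS : ∀ w : InfinitePlace F, Sum.inl w ∈ S) :
    Function.Exact (prodToPlaces hST) (placesToClassGroup S T) := by
  intro (q : MonoidAlgebra ℤ T)
  change divisorClass (finitePart S) (finiteDivisor T q) = 0 ↔ _
  rw [divisorClass_eq_zero_iff]
  constructor
  · rintro ⟨x, hx⟩
    obtain ⟨u, hu⟩ := exists_sUnitsVal_eq (S := T) (x := x) fun v hv ↦ by
      rw [← hx v fun h ↦ hv (finitePart_mono hST h), finiteDivisor_of_notMem _ hv]
    obtain ⟨r, hr⟩ := exists_placesInclusion_eq hST (q - sUnitsDivisor T u) <| by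
      rintro ⟨w | v, hpT⟩ hp
      · exact absurd (hS w) hp
      · have h1 := hx v hp
        rw [finiteDivisor_of_mem _ hpT] at h1
        have h2 := coeff_sUnitsDivisor u ⟨Sum.inr v, hpT⟩
        rw [hu] at h2
        exact sub_eq_zero.mpr (h1.trans h2.symm)
    refine ⟨(u, r), ?_⟩
    change sUnitsDivisor T u + placesInclusion hST r = q
    rw [hr, add_sub_cancel]
  · rintro ⟨⟨(u : Additive (SIntegers T)ˣ), (r : MonoidAlgebra ℤ S)⟩, rfl⟩
    refine ⟨(sUnitsVal T u).toMul, fun v hv ↦ ?_⟩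
    change finiteDivisor T (sUnitsDivisor T u + placesInclusion hST r) v = _
    rw [map_add, Finsupp.add_apply, finiteDivisor_sUnitsDivisor, finiteDivisor_placesInclusion,
      finiteDivisor_of_notMem _ hv, add_zero]
    rfl

omit [Finite S] in
theorem exact_placesToClassGroup_classGroupMap :
    Function.Exact (placesToClassGroup S T)
      ((classGroupMap hST).asModuleHom (classGroupMap_classGroupRep hST)) := by
  classical
  intro c
  obtain ⟨n, rfl⟩ := divisorClass_surjective (finitePart S) c
  change classGroupMap hST (divisorClass (finitePart S) n) = 0 ↔ _
  rw [classGroupMap_divisorClass, divisorClass_eq_zero_iff]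
  constructor
  · rintro ⟨x, hx⟩
    -- Restrict n - div x to `T`. Outside `T` that difference is already zero, so `q` has the class
    -- of `n` in Cl_S. The Archimedean value is irrelevant, since `finiteDivisor` discards it.
    let q : MonoidAlgebra ℤ T := .ofCoeff (Finsupp.equivFunOnFinite.symm fun p ↦
      Sum.elim (fun _ ↦ 0) (fun v ↦ n v - valuationInt v (Additive.ofMul x)) p.1)
    refine ⟨q, ?_⟩
    change divisorClass (finitePart S) (finiteDivisor T q) = _
    rw [eq_comm, ← sub_eq_zero, ← map_sub, divisorClass_eq_zero_iff]
    refine ⟨x, fun v hv ↦ ?_⟩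
    rw [Finsupp.sub_apply]
    by_cases hvT : v ∈ finitePart T
    · rw [finiteDivisor_of_mem _ hvT]
      exact sub_sub_cancel _ _
    · rw [finiteDivisor_of_notMem _ hvT, hx v hvT, sub_zero]
  · rintro ⟨(q : MonoidAlgebra ℤ T), hq⟩
    change divisorClass (finitePart S) (finiteDivisor T q) = divisorClass (finitePart S) n at hq
    rw [← divisorClass_eq_zero_iff, ← classGroupMap_divisorClass hST, ← hq,
      classGroupMap_divisorClass, divisorClass_eq_zero_iff]
    -- The divisor of `q` is supported on `T`, so the trivial element 1 shows that its class in Cl_T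
    -- vanishes.
    exact ⟨1, fun v hv ↦ by rw [finiteDivisor_of_notMem _ hv, ofMul_one, map_zero]⟩

include hST in
theorem G0.cls_sub_add_eq_of_le (hS : ∀ w : InfinitePlace F, Sum.inl w ∈ S) :
    G0.cls (MonoidAlgebra ℤ Gal(F/K)) (PlacesModule T)
        - G0.cls (MonoidAlgebra ℤ Gal(F/K)) (SUnitsModule T)
        + G0.cls (MonoidAlgebra ℤ Gal(F/K)) (SClassGroupModule T) =
      G0.cls (MonoidAlgebra ℤ Gal(F/K)) (PlacesModule S)
        - G0.cls (MonoidAlgebra ℤ Gal(F/K)) (SUnitsModule S)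
        + G0.cls (MonoidAlgebra ℤ Gal(F/K)) (SClassGroupModule S) := by
  have h := G0.cls_five_term (sUnitsToProd hST) (prodToPlaces hST) (placesToClassGroup S T)
    ((classGroupMap hST).asModuleHom (classGroupMap_classGroupRep hST))
    (sUnitsToProd_injective hST) (exact_sUnitsToProd_prodToPlaces hST hS)
    (exact_prodToPlaces_placesToClassGroup hST hS)
    (exact_placesToClassGroup_classGroupMap hST) (classGroupMap_surjective hST)
  rw [G0.cls_prod] at h
  rw [← sub_eq_zero] at h ⊢
  rw [← h]
  abel

end Galois

theorem mainTheorem6 {K : Type*} {F : Type u} [Field K] [NumberField K] [Field F] [NumberField F]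
    [Algebra K F] [IsGalois K F]
    (S S' : SubMulAction Gal(F/K) (Place F)) [Finite S] [Finite S']
    (hS : ∀ w : InfinitePlace F, Sum.inl w ∈ S)
    (hS' : ∀ w : InfinitePlace F, Sum.inl w ∈ S') :
    G0.cls (MonoidAlgebra ℤ Gal(F/K)) (PlacesModule S')
        - G0.cls (MonoidAlgebra ℤ Gal(F/K)) (SUnitsModule S')
        + G0.cls (MonoidAlgebra ℤ Gal(F/K)) (SClassGroupModule S') =
      G0.cls (MonoidAlgebra ℤ Gal(F/K)) (PlacesModule S)
        - G0.cls (MonoidAlgebra ℤ Gal(F/K)) (SUnitsModule S)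
        + G0.cls (MonoidAlgebra ℤ Gal(F/K)) (SClassGroupModule S) := by
  -- The union is a finite stable set containing both, so each side equals its invariant.
  have : Finite ↥(S ⊔ S') :=
    ((Set.toFinite (S : Set (Place F))).union (Set.toFinite (S' : Set (Place F)))).to_subtype
  rw [← G0.cls_sub_add_eq_of_le (le_sup_left : S ≤ S ⊔ S') hS,
    ← G0.cls_sub_add_eq_of_le (le_sup_right : S' ≤ S ⊔ S') hS']
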